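/- **Statistical utility of RecExp.** Let $n,m\ge 1$ and $\epsilon>0$. Let $X_1,\dots,X_n$ be i.i.d. with a density $\pi$ on $[0,1]$ with respect to Lebesgue measure such that $0<\underline{\pi}\le \pi\le\bar\pi<\infty$ almost everywhere on $[0,1]$; let $F_\pi$ be its distribution function and $F_\pi^{-1}(p)=\inf\{t: F_\pi(t)\ge p\}$. Let $p_1<\dots<p_m$ be orders in $(0,1)$ with $\min_i\min(p_i,1-p_i)>2/n$. *QExp.* Given points $x_1,\dots,x_N$, an interval $[a,b]$, an order $p$ and a budget $\epsilon'$, QExp returns a random $v\in[a,b]$ whose density with respect to Lebesgue measure on $[a,b]$ is proportional to $$v\mapsto \exp\Big(-\tfrac{\epsilon'}{2}\,\big|\,|\{i: x_i<v\}|-\lfloor Np\rfloor\,\big|\Big).$$ *RecExp.* Given a dataset in $[0,1]$ and orders $p_1<\dots<p_m$, RecExp starts with the whole dataset, the interval $[0,1]$ and all the orders, and proceeds recursively, every call of QExp having budget $\epsilon'=\epsilon/(\log_2 m+1)$ and fresh independent randomness. On an interval $[a,b]$, some points and orders $r_1<\dots<r_k$: if $k=0$, return nothing. Otherwise put $c=\lceil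 k/2\rceil$ and let $v$ be the output of QExp on these points, the interval $[a,b]$ and the order $r_c$; this is the estimate for the original order corresponding to $r_c$. Then recurse on the points $<v$ in the interval $[a,v]$ with the orders $r_j/r_c$, $j<c$, and on the points $>v$ in the interval $[v,b]$ with the orders $(r_j-r_c)/(1-r_c)$, $j>c$. Let $\mathbf q=(q_1,\dots,q_m)$ be the output of RecExp on $(X_1,\dots,X_n)$ and $F_\pi^{-1}(\mathbf p)=(F_\pi^{-1}(p_1),\dots,F_\pi^{-1}(p_m))$. Then for every $\gamma\in\Big(0,\tfrac{2\min_i\min(p_i,1-p_i)}{\underline\pi}\Big)$, $$\mathbb P\big(\|\mathbf q-F_\pi^{-1}(\mathbf p)\|_\infty>\gamma\big)\le 4n\sqrt{2e\bar\pi m}\;\exp\Big(-\frac{\epsilon n\gamma\underline\pi}{32\,(\log_2(2m))^2}\Big)+4m\,\exp\Big(-\frac{\gamma^2\underline\pi^2}{8}\,n\Big),$$ where the probability is over both the sample and the randomness of RecExp. -/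

import Mathlib

open MeasureTheory ProbabilityTheory
open scoped ENNReal

noncomputable section

namespace PrivateQuantile

/-- The input of a call of a quantile mechanism: data points `x`, the set `S` of indices of the
points that the call is allowed to look at, and the endpoints `a`, `b` of its output interval. -/
abbrev Input (n : ℕ) : Type := (Fin n → ℝ) × Finset (Fin n) × ℝ × ℝ

namespace Input

variable {n : ℕ}

/-- The data points. -/
abbrev x (s : Input n) : Fin n → ℝ := s.1

/-- The indices of the points that are in use. -/
abbrev S (s : Input n) : Finset (Fin n) := s.2.1

/-- The left endpoint of the output interval. -/
abbrev a (s : Input n) : ℝ := s.2.2.1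

/-- The right endpoint of the output interval. -/
abbrev b (s : Input n) : ℝ := s.2.2.2

/-- The whole dataset `x`, with output interval `[0, 1]`. -/
def root (x : Fin n → ℝ) : Input n := (x, Finset.univ, 0, 1)

/-- The points in use that lie strictly below `v`, with output interval `[a, v]`. -/
def lower (t : Input n × ℝ) : Input n := (t.1.x, {i ∈ t.1.S | t.1.x i < t.2}, t.1.a, t.2)

/-- The points in use that lie strictly above `v`, with output interval `[v, b]`. -/
def upper (t : Input n × ℝ) : Input n := (t.1.x, {i ∈ t.1.S | t.2 < t.1.x i}, t.2, t.1.b)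

lemma measurable_root : Measurable (root (n := n)) := by
  unfold root; fun_prop

lemma measurable_filter_lt :
    Measurable fun t : Input n × ℝ => ({i ∈ t.1.S | t.1.x i < t.2} : Finset (Fin n)) := by
  rw [measurable_finset_iff]
  intro i
  simp only [Finset.mem_filter]
  refine Measurable.and ?_ ?_
  · exact (measurable_finset_mem i).comp (by fun_prop)
  · exact measurableSet_setOfPred.1 (measurableSet_lt (by fun_prop) (by fun_prop))

lemma measurable_filter_gt :
    Measurable fun t : Input n × ℝ => ({i ∈ t.1.S | t.2 < t.1.x i} : Finset (Fin n)) := by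
  rw [measurable_finset_iff]
  intro i
  simp only [Finset.mem_filter]
  refine Measurable.and ?_ ?_
  · exact (measurable_finset_mem i).comp (by fun_prop)
  · exact measurableSet_setOfPred.1 (measurableSet_lt (by fun_prop) (by fun_prop))

lemma measurable_lower : Measurable (lower (n := n)) := by
  have := measurable_filter_lt (n := n)
  unfold lower; fun_prop

lemma measurable_upper : Measurable (upper (n := n)) := by
  have := measurable_filter_gt (n := n)
  unfold upper; fun_prop

end Input

variable {n : ℕ}

/-- The utility `-| |{i | xᵢ < v}| - ⌊N p⌋ |` of the output `v` for the quantile of order `p` of the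
`N` points in use. -/
def utility (p : ℝ) (s : Input n) (v : ℝ) : ℝ :=
  -|((({i ∈ s.S | s.x i < v} : Finset (Fin n)).card : ℕ) : ℝ) - (⌊(s.S.card : ℝ) * p⌋ : ℤ)|

/-- The unnormalized density of the exponential mechanism with budget `ε` and the utility above,
whose sensitivity is `1`, on the interval `[a, b]`. -/
def weight (ε p : ℝ) (s : Input n) (v : ℝ) : ℝ≥0∞ :=
  (Set.Icc s.a s.b).indicator (fun v => ENNReal.ofReal (Real.exp (ε / 2 * utility p s v))) v

lemma measurable_card : Measurable (Finset.card : Finset (Fin n) → ℕ) := .of_discrete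

lemma measurable_utility (p : ℝ) :
    Measurable fun t : Input n × ℝ => utility p t.1 t.2 := by
  unfold utility
  have h1 : Measurable fun t : Input n × ℝ =>
      ((({i ∈ t.1.S | t.1.x i < t.2} : Finset (Fin n)).card : ℕ) : ℝ) :=
    measurable_from_top.comp (measurable_card.comp Input.measurable_filter_lt)
  have h2 : Measurable fun t : Input n × ℝ => ((⌊(t.1.S.card : ℝ) * p⌋ : ℤ) : ℝ) :=
    (Measurable.of_discrete (f := fun S : Finset (Fin n) => ((⌊(S.card : ℝ) * p⌋ : ℤ) : ℝ))).comp
      (by fun_prop)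
  exact ((continuous_abs.measurable.comp (h1.sub h2))).neg

lemma measurable_weight (ε p : ℝ) :
    Measurable (Function.uncurry (weight (n := n) ε p)) := by
  have hset1 : MeasurableSet {t : Input n × ℝ | t.1.a ≤ t.2} :=
    measurableSet_le (by fun_prop) (by fun_prop)
  have hset2 : MeasurableSet {t : Input n × ℝ | t.2 ≤ t.1.b} :=
    measurableSet_le (by fun_prop) (by fun_prop)
  have hset : MeasurableSet {t : Input n × ℝ | t.2 ∈ Set.Icc t.1.a t.1.b} := hset1.inter hset2
  have hf : Measurable fun t : Input n × ℝ =>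
      ENNReal.ofReal (Real.exp (ε / 2 * utility p t.1 t.2)) := by
    have := measurable_utility (n := n) p
    fun_prop
  exact hf.indicator hset

/-- The density of QExp on `[a, b]` with respect to Lebesgue measure: proportional to
`exp (ε u / 2)`. -/
def density (ε p : ℝ) (s : Input n) (v : ℝ) : ℝ≥0∞ :=
  weight ε p s v / ∫⁻ w, weight ε p s w

lemma measurable_density (ε p : ℝ) :
    Measurable (Function.uncurry (density (n := n) ε p)) := by
  have h := measurable_weight (n := n) ε p
  have h2 : Measurable fun s : Input n => ∫⁻ w, weight ε p s w := h.lintegral_prod_right'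
  exact h.div (h2.comp measurable_fst)

lemma measurableSet_lt_endpoints : MeasurableSet {s : Input n | s.a < s.b} :=
  measurableSet_lt (by fun_prop) (by fun_prop)

open scoped Classical in
/-- The law of the output of QExp, run with budget `ε` for the order `p`. On a degenerate interval
(`b ≤ a`, which RecExp meets with probability zero) the output is `a`. -/
def qExp (ε p : ℝ) : Kernel (Input n) ℝ :=
  Kernel.piecewise measurableSet_lt_endpoints
    (Kernel.withDensity (Kernel.const _ volume) (density ε p))
    (Kernel.deterministic (fun s => s.a) (by fun_prop))

lemma lintegral_weight (ε p : ℝ) (s : Input n) (hs : s.a < s.b) :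
    (∫⁻ w, weight ε p s w) ≠ 0 ∧ (∫⁻ w, weight ε p s w) ≠ ∞ := by
  have hm : Measurable fun v => ENNReal.ofReal (Real.exp (ε / 2 * utility p s v)) := by
    have h := (measurable_utility (n := n) p).comp (measurable_prodMk_left (x := s))
    have h' : Measurable fun v => utility p s v := h
    fun_prop
  have hw : (∫⁻ w, weight ε p s w) =
      ∫⁻ w in Set.Icc s.a s.b, ENNReal.ofReal (Real.exp (ε / 2 * utility p s w)) := by
    rw [← lintegral_indicator measurableSet_Icc]; rfl
  rw [hw]
  constructor
  · rw [Ne, lintegral_eq_zero_iff hm]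
    intro h
    have h0 : volume (Set.Icc s.a s.b) = 0 := by
      have h' : ∀ᵐ w ∂volume.restrict (Set.Icc s.a s.b), False := by
        filter_upwards [h] with w hw
        have := Real.exp_pos (ε / 2 * utility p s w)
        simp at hw
        linarith
      rw [ae_iff] at h'
      simp only [not_false_eq_true] at h'
      rw [← Measure.restrict_apply_univ]
      exact h'
    rw [Real.volume_Icc] at h0
    simp at h0
    linarith
  · have hb : ∀ w, utility p s w ≤ 0 ∧
        -((n : ℝ) + |((⌊(s.S.card : ℝ) * p⌋ : ℤ) : ℝ)|) ≤ utility p s w := by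
      intro w
      unfold utility
      refine ⟨by simp, ?_⟩
      have h1 : ((({i ∈ s.S | s.x i < w} : Finset (Fin n)).card : ℕ) : ℝ) ≤ n := by
        exact_mod_cast (Finset.card_le_univ _).trans (by simp)
      have h2 := abs_sub ((({i ∈ s.S | s.x i < w} : Finset (Fin n)).card : ℕ) : ℝ)
        ((⌊(s.S.card : ℝ) * p⌋ : ℤ) : ℝ)
      rw [Nat.abs_cast] at h2
      linarith
    set C := (n : ℝ) + |((⌊(s.S.card : ℝ) * p⌋ : ℤ) : ℝ)|
    refine ne_of_lt (lt_of_le_of_lt (lintegral_mono (g := fun _ =>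
      ENNReal.ofReal (Real.exp (|ε / 2| * C))) fun w => ?_) ?_)
    · refine ENNReal.ofReal_le_ofReal (Real.exp_le_exp.2 ?_)
      refine (le_abs_self _).trans ?_
      rw [abs_mul]
      refine mul_le_mul_of_nonneg_left ?_ (abs_nonneg _)
      rw [abs_of_nonpos (hb w).1]
      linarith [(hb w).2]
    · simp [ENNReal.mul_lt_top_iff]

instance (ε p : ℝ) : IsMarkovKernel (qExp (n := n) ε p) := by
  refine ⟨fun s => ⟨?_⟩⟩
  unfold qExp
  rw [Kernel.piecewise_apply]
  split_ifs with hs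
  · rw [Kernel.withDensity_apply' _ (measurable_density ε p)]
    have h := lintegral_weight ε p s hs
    simp only [Measure.restrict_univ, Kernel.const_apply, density, div_eq_mul_inv]
    rw [lintegral_mul_const' _ _ (by simpa using h.1)]
    exact ENNReal.mul_inv_cancel h.1 h.2
  · simp

/-- The vector whose first coordinates are those of `l`, followed by `v`, followed by those of `r`,
where `v` has position `k / 2` (counted from `0`). -/
def join (k : ℕ) (t : ℝ × (Fin (k / 2) → ℝ) × (Fin (k - k / 2) → ℝ)) : Fin (k + 1) → ℝ :=
  fun i =>
    if hl : i.val < k / 2 then t.2.1 ⟨i.val, hl⟩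
    else if hr : k / 2 < i.val then t.2.2 ⟨i.val - (k / 2 + 1), by omega⟩
    else t.1

lemma measurable_join (k : ℕ) : Measurable (join k) := by
  refine measurable_pi_iff.2 fun i => ?_
  unfold join
  split_ifs <;> fun_prop

/-- The recursion of RecExp, each call of QExp having budget `ε`. For increasing orders
`p₀ < ... < pₖ`, QExp estimates the quantile of the median order `p_c`, `c = ⌊k / 2⌋`, by `v`. Then,
with independent randomness, the recursion is run on the points below `v` in the interval `[a, v]`
for the orders `pⱼ / p_c`, `j < c`, and on the points above `v` in the interval `[v, b]` for the
orders `(pⱼ - p_c) / (1 - p_c)`, `j > c`. -/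
def recursion (ε : ℝ) : (m : ℕ) → (Fin m → ℝ) → Kernel (Input n) (Fin m → ℝ)
  | 0, _ => Kernel.const _ (Measure.dirac Fin.elim0)
  | k + 1, p =>
    let pc : ℝ := p ⟨k / 2, by omega⟩
    let left : Kernel (Input n) (Fin (k / 2) → ℝ) :=
      recursion ε (k / 2) fun j => p ⟨j.val, by omega⟩ / pc
    let right : Kernel (Input n) (Fin (k - k / 2) → ℝ) :=
      recursion ε (k - k / 2) fun j => (p ⟨k / 2 + 1 + j.val, by omega⟩ - pc) / (1 - pc)
    (qExp ε pc ⊗ₖ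
      (left.comap Input.lower Input.measurable_lower ×ₖ
        right.comap Input.upper Input.measurable_upper)).map (join k)
  termination_by m => m
  decreasing_by all_goals omega

instance isMarkovKernel_recursion (ε : ℝ) (m : ℕ) (p : Fin m → ℝ) :
    IsMarkovKernel (recursion (n := n) ε m p) := by
  induction m using Nat.strong_induction_on with
  | _ m ih =>
    cases m with
    | zero => rw [recursion]; infer_instance
    | succ k =>
      rw [recursion]
      have h1 := fun p => ih (k / 2) (by omega) p
      have h2 := fun p => ih (k - k / 2) (by omega) p
      exact Kernel.IsMarkovKernel.map _ (measurable_join k)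

/-- The law of the output of RecExp on the dataset `x` with total privacy budget `ε` for the orders
`p₀ < ... < p_{m-1}`: every call of QExp has budget `ε / (log₂ m + 1)`. -/
def recExp (ε : ℝ) {m : ℕ} (p : Fin m → ℝ) : Kernel (Fin n → ℝ) (Fin m → ℝ) :=
  (recursion (ε / (Real.logb 2 m + 1)) m p).comap Input.root Input.measurable_root

instance (ε : ℝ) {m : ℕ} (p : Fin m → ℝ) : IsMarkovKernel (recExp (n := n) ε p) := by
  unfold recExp; infer_instance

/-- The measure on `[0, 1]` with density `f` with respect to Lebesgue measure. -/
def unitLaw (f : ℝ → ℝ) : Measure ℝ :=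
  (volume.restrict (Set.Icc 0 1)).withDensity fun t => ENNReal.ofReal (f t)

/-- The quantile function `F⁻¹(p) = inf {t | p ≤ F(t)}`, where `F` is the distribution function. -/
def quantile (μ : Measure ℝ) (p : ℝ) : ℝ := sInf {t | p ≤ cdf μ t}

end PrivateQuantile

end

/-!
The output `q` is compared with `F⁻¹(p)` through ranks in the sample. Write `D = n γ lo` and
`L = log₂ (2 m)`, so that every call of QExp has budget `ε / L` and there are at most `L` levels.

*One call* (`qExp_rank_error_le`). If the `N` points in use have mutual distances at least `g`, the
normalizing integral of QExp is at least the weight of a gap between two consecutive points whose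
rank is within `1` of `⌊N p⌋`. Hence the rank of the output misses `N p` by more than `t + 1` with
probability at most `exp (-ε' t / 2) / g`, where `ε'` is the budget of the call. Only gaps between
data points are used, since the endpoints of the interval are outputs of earlier calls and may be
very close to a data point; for `N ≤ 1` there is nothing to prove, as all rank errors are below `1`.

*The recursion* (`join_mem_accurate`, `recursion_accurate_compl_le`). The rank error of a call
enters those of its descendants by linear interpolation, with a factor at most `1`. So the errors of
the levels add up: all ranks are within `L (t + 1)` of `n pᵢ`, except with probability
`m exp (-ε' t / 2) / g`.

*The sample* (`measure_count_ge_le`, `measure_abs_sub_lt_le`). Hoeffding's inequality at the `2 m`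
points `F⁻¹(pᵢ) ± γ` costs `2 m exp (-γ² lo² n / 8)`, and two of the points are closer than `g` with
probability at most `2 n² hi g`. Outside these events a point at distance more than `γ` from
`F⁻¹(pᵢ)` has a rank at least `3 D / 4` away from `n pᵢ` (`abs_sub_quantile_le`).

With `t = D / (8 L)` the recursion yields rank errors of at most `D / 8 + L`, which is less than
`3 D / 4` unless `L ≥ 5 D / 8`; in that case the claimed bound is at least `1`
(`one_le_of_le_logb`). The separation `g` is chosen to balance `2 n² hi g` against
`m exp (-ε' t / 2) / g`.
-/

namespace PrivateQuantile

/-! ### The rank of a point, and accuracy of QExp -/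

/-- The rank of `v` in the points in use: how many of them lie strictly below `v`. -/
noncomputable def rank {n : ℕ} (x : Fin n → ℝ) (S : Finset (Fin n)) (v : ℝ) : ℕ :=
  ({i ∈ S | x i < v} : Finset (Fin n)).card

lemma rank_le_card {n : ℕ} (x : Fin n → ℝ) (S : Finset (Fin n)) (v : ℝ) : rank x S v ≤ S.card :=
  Finset.card_filter_le _ _

lemma measurable_rank {n : ℕ} (x : Fin n → ℝ) (S : Finset (Fin n)) :
    Measurable fun v => (rank x S v : ℝ) := by
  have h : Measurable fun v : ℝ => (((x, S, 0, 0), v) : Input n × ℝ) := by fun_prop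
  exact measurable_from_top.comp (measurable_card.comp (Input.measurable_filter_lt.comp h))

/-- Distinct points have a gap between the `k`-th and the `(k + 1)`-st smallest of them, on which
the rank is `k`. -/
lemma exists_rank_eq {n : ℕ} (x : Fin n → ℝ) (S : Finset (Fin n)) (hx : Set.InjOn x S) (k : ℕ)
    (hk : 1 ≤ k) (hkS : k < S.card) :
    ∃ i ∈ S, ∃ j ∈ S, x i < x j ∧ ∀ v, x i < v → v ≤ x j → rank x S v = k := by
  classical
  have hcard : (S.image x).card = S.card := Finset.card_image_of_injOn hx
  set e := (S.image x).orderEmbOfFin hcard with he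
  have hmem : ∀ l, ∃ i ∈ S, x i = e l := fun l =>
    Finset.mem_image.1 ((S.image x).orderEmbOfFin_mem hcard l)
  obtain ⟨i, hi, hxi⟩ := hmem ⟨k - 1, by omega⟩
  obtain ⟨j, hj, hxj⟩ := hmem ⟨k, hkS⟩
  refine ⟨i, hi, j, hj, ?_, fun v hv1 hv2 => ?_⟩
  · rw [hxi, hxj, e.lt_iff_lt, Fin.mk_lt_mk]; omega
  · rw [hxi] at hv1
    rw [hxj] at hv2
    have h1 : rank x S v = ((S.image x).filter (· < v)).card := by
      rw [Finset.filter_image, Finset.card_image_of_injOn]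
      · rfl
      · exact hx.mono (Finset.coe_subset.2 (Finset.filter_subset _ _))
    have h2 : (S.image x).filter (· < v) =
        ((Finset.univ : Finset (Fin S.card)).filter (fun l => l.val < k)).image e := by
      rw [← Finset.image_orderEmbOfFin_univ (S.image x) hcard, Finset.filter_image]
      congr 1
      ext l
      simp only [Finset.mem_filter, Finset.mem_univ, true_and]
      constructor
      · intro hl
        exact e.lt_iff_lt.1 (hl.trans_le hv2)
      · intro hl
        refine lt_of_le_of_lt (e.le_iff_le.2 ?_) hv1
        rw [Fin.le_def]
        show l.val ≤ k - 1
        omega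
    rw [h1, h2, Finset.card_image_of_injective _ e.injective]
    rw [Fin.card_filter_val_lt, min_eq_right hkS.le]

/-- The points in use are separated by at least `g`, and lie in the output interval, which is
nondegenerate and of length at most `1`. -/
structure WellSpaced {n : ℕ} (g : ℝ) (s : Input n) : Prop where
  lt : s.a < s.b
  length_le : s.b - s.a ≤ 1
  mem : ∀ i ∈ s.S, s.x i ∈ Set.Icc s.a s.b
  gap : ∀ i ∈ s.S, ∀ j ∈ s.S, s.x i < s.x j → g ≤ s.x j - s.x i
  injOn : Set.InjOn s.x s.S

lemma qExp_apply_of_lt {n : ℕ} (ε p : ℝ) (s : Input n) (hs : s.a < s.b) (B : Set ℝ) :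
    qExp ε p s B = ∫⁻ v in B, density ε p s v := by
  have hs' : s ∈ {s : Input n | s.a < s.b} := hs
  rw [qExp, Kernel.piecewise_apply, if_pos hs',
    Kernel.withDensity_apply' _ (measurable_density ε p), Kernel.const_apply]

lemma qExp_absolutelyContinuous {n : ℕ} (ε p : ℝ) (s : Input n) (hs : s.a < s.b) :
    qExp ε p s ≪ volume := by
  intro B hB
  rw [qExp_apply_of_lt ε p s hs, Measure.restrict_eq_zero.2 hB, lintegral_zero_measure]

/-- The output of QExp almost surely lies in the open interval and is not a data point. -/
lemma ae_qExp {n : ℕ} (ε p : ℝ) (s : Input n) (hs : s.a < s.b) :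
    ∀ᵐ v ∂qExp ε p s, s.a < v ∧ v < s.b ∧ ∀ i, s.x i ≠ v := by
  have h1 : ∀ᵐ v ∂qExp ε p s, v ∈ Set.Icc s.a s.b := by
    rw [ae_iff, show {v | v ∉ Set.Icc s.a s.b} = (Set.Icc s.a s.b)ᶜ from rfl,
      qExp_apply_of_lt ε p s hs, setLIntegral_congr_fun measurableSet_Icc.compl (g := 0),
      Pi.zero_def, lintegral_zero]
    intro v hv
    simp [density, weight, Set.indicator_of_notMem (show v ∉ Set.Icc s.a s.b from hv)]
  have h2 : ∀ y : ℝ, ∀ᵐ v ∂qExp ε p s, v ≠ y := fun y =>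
    (qExp_absolutelyContinuous ε p s hs).ae_le (Measure.ae_ne volume y)
  filter_upwards [h1, h2 s.a, h2 s.b, ae_all_iff.2 fun i => h2 (s.x i)] with v hv ha hb hx
  exact ⟨lt_of_le_of_ne hv.1 ha.symm, lt_of_le_of_ne hv.2 hb, fun i => (hx i).symm⟩

/-- Accuracy of QExp: the probability that the rank of the output misses `N p` by more than `t + 1`
is at most `exp (-ε t / 2) / g`. The weight of that event is compared with the weight of the gap
between two consecutive data points, whose length is at least `g`. -/
lemma qExp_rank_error_le {n : ℕ} {ε p g t : ℝ} (hε : 0 ≤ ε) (hp0 : 0 < p) (hp1 : p < 1)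
    (hg : 0 < g) (ht : 0 ≤ t) (s : Input n) (hs : WellSpaced g s) :
    qExp ε p s {v | t + 1 < |(rank s.x s.S v : ℝ) - s.S.card * p|} ≤
      ENNReal.ofReal (Real.exp (-(ε * t / 2)) / g) := by
  set B := {v | t + 1 < |(rank s.x s.S v : ℝ) - s.S.card * p|} with hB
  set N := s.S.card with hN
  rcases Nat.lt_or_ge N 2 with hN2 | hN2
  · have hempty : B = ∅ := by
      ext v
      simp only [hB, Set.mem_ofPred_eq, Set.mem_empty_iff_false, iff_false, not_lt]
      have h1 := rank_le_card s.x s.S v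
      refine le_trans ?_ (show (1 : ℝ) ≤ t + 1 by linarith)
      rw [← hN] at h1
      interval_cases N
      · simp [Nat.le_zero.1 h1]
      · interval_cases rank s.x s.S v <;> rw [abs_le] <;> norm_num <;> constructor <;> linarith
    rw [hempty]; simp
  · obtain ⟨k, hk⟩ : ∃ k : ℕ, ⌊(N : ℝ) * p⌋ = k :=
      Int.eq_ofNat_of_zero_le (Int.floor_nonneg.2 (by positivity))
    have hk1 : (k : ℝ) ≤ N * p := by
      have := Int.floor_le ((N : ℝ) * p); rw [hk] at this; exact_mod_cast this
    have hk2 : (N : ℝ) * p < k + 1 := by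
      have := Int.lt_floor_add_one ((N : ℝ) * p); rw [hk] at this; exact_mod_cast this
    have hNpos : (0 : ℝ) < N := by positivity
    have hkN : k < N := by
      have : (k : ℝ) < N := hk1.trans_lt (by nlinarith)
      exact_mod_cast this
    have hut : ∀ v, utility p s v = -|(rank s.x s.S v : ℝ) - k| := by
      intro v
      have hc : ((s.S.card : ℕ) : ℝ) = N := rfl
      simp only [utility, rank, hc, hk]
      norm_num
    -- If `⌊N p⌋ = 0` the optimal interval reaches down to `a` and may be arbitrarily short, so the
    -- next gap is used.
    obtain ⟨i, hi, j, hj, hij, hrank⟩ :=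
      exists_rank_eq s.x s.S hs.injOn (max k 1) (le_max_right _ _) (max_lt hkN (by omega))
    set u : ℝ := |((max k 1 : ℕ) : ℝ) - k| with hu
    have hZ : ENNReal.ofReal (Real.exp (ε / 2 * -u) * g) ≤ ∫⁻ w, weight ε p s w := by
      calc ENNReal.ofReal (Real.exp (ε / 2 * -u) * g)
          ≤ ENNReal.ofReal (Real.exp (ε / 2 * -u)) * volume (Set.Ioc (s.x i) (s.x j)) := by
            rw [Real.volume_Ioc, ← ENNReal.ofReal_mul (Real.exp_nonneg _)]
            gcongr
            exact hs.gap i hi j hj hij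
        _ = ∫⁻ w in Set.Ioc (s.x i) (s.x j), ENNReal.ofReal (Real.exp (ε / 2 * -u)) := by
            rw [setLIntegral_const]
        _ ≤ ∫⁻ w in Set.Ioc (s.x i) (s.x j), weight ε p s w := by
            refine setLIntegral_mono' measurableSet_Ioc fun w hw => ?_
            rw [weight, Set.indicator_of_mem, hut, hrank w hw.1 hw.2]
            exact ⟨(hs.mem i hi).1.trans hw.1.le, hw.2.trans (hs.mem j hj).2⟩
        _ ≤ ∫⁻ w, weight ε p s w := setLIntegral_le_lintegral _ _
    have hW : ∫⁻ v in B, weight ε p s v ≤ ENNReal.ofReal (Real.exp (ε / 2 * -(t + u))) := by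
      have hle : ∀ v ∈ B, weight ε p s v ≤ (Set.Icc s.a s.b).indicator
          (fun _ => ENNReal.ofReal (Real.exp (ε / 2 * -(t + u)))) v := by
        intro v hv
        rw [weight]
        refine Set.indicator_le_indicator (ENNReal.ofReal_le_ofReal (Real.exp_le_exp.2 ?_))
        refine mul_le_mul_of_nonneg_left ?_ (by positivity)
        rw [hut, neg_le_neg_iff]
        have hv' : t + 1 < |(rank s.x s.S v : ℝ) - N * p| := hv
        have hr0 : (0 : ℝ) ≤ rank s.x s.S v := by positivity
        rcases Nat.eq_zero_or_pos k with h0 | h0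
        · subst h0
          simp only [hu, Nat.cast_zero, sub_zero, zero_le, sup_of_le_right, Nat.cast_one, abs_one]
          rw [abs_of_nonneg hr0]
          simp only [Nat.cast_zero, zero_add] at hk2 hk1
          rcases lt_abs.1 hv' with h | h <;> linarith
        · have : max k 1 = k := max_eq_left h0
          simp only [hu, this, sub_self, abs_zero, add_zero]
          rcases lt_abs.1 hv' with h | h
          · exact le_trans (by linarith) (le_abs_self _)
          · exact le_trans (by linarith) (neg_le_abs _)
      have hBm : MeasurableSet B :=
        measurableSet_lt measurable_const
          (continuous_abs.measurable.comp ((measurable_rank s.x s.S).sub measurable_const))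
      calc ∫⁻ v in B, weight ε p s v
          ≤ ∫⁻ v in B, (Set.Icc s.a s.b).indicator
              (fun _ => ENNReal.ofReal (Real.exp (ε / 2 * -(t + u)))) v :=
            setLIntegral_mono' hBm hle
        _ ≤ ∫⁻ v, (Set.Icc s.a s.b).indicator
              (fun _ => ENNReal.ofReal (Real.exp (ε / 2 * -(t + u)))) v :=
            setLIntegral_le_lintegral _ _
        _ = ENNReal.ofReal (Real.exp (ε / 2 * -(t + u))) * ENNReal.ofReal (s.b - s.a) := by
            rw [lintegral_indicator measurableSet_Icc, setLIntegral_const, Real.volume_Icc]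
        _ ≤ ENNReal.ofReal (Real.exp (ε / 2 * -(t + u))) * 1 := by
            gcongr
            exact ENNReal.ofReal_le_one.2 hs.length_le
        _ = _ := mul_one _
    rw [qExp_apply_of_lt ε p s hs.lt]
    simp only [density, div_eq_mul_inv]
    rw [lintegral_mul_const' _ _ (by simpa using (lintegral_weight ε p s hs.lt).1),
      ← div_eq_mul_inv, ← div_eq_mul_inv]
    refine (ENNReal.div_le_div hW hZ).trans_eq ?_
    rw [← ENNReal.ofReal_div_of_pos (by positivity)]
    congr 1
    rw [show ε / 2 * -(t + u) = -(ε * t / 2) + ε / 2 * -u by ring, Real.exp_add]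
    field_simp

/-! ### Accuracy of the recursion -/

section

variable {n : ℕ}

lemma mem_lower {s : Input n} {v : ℝ} {i : Fin n} :
    i ∈ (Input.lower (s, v)).S ↔ i ∈ s.S ∧ s.x i < v := Finset.mem_filter

lemma mem_upper {s : Input n} {v : ℝ} {i : Fin n} :
    i ∈ (Input.upper (s, v)).S ↔ i ∈ s.S ∧ v < s.x i := Finset.mem_filter

lemma WellSpaced.lower {g : ℝ} {s : Input n} (hs : WellSpaced g s) {v : ℝ} (hav : s.a < v)
    (hvb : v < s.b) : WellSpaced g (Input.lower (s, v)) := by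
  refine ⟨hav, ?_, fun i hi => ?_, fun i hi j hj => ?_, hs.injOn.mono ?_⟩
  · have := hs.length_le
    show v - s.a ≤ 1
    linarith
  · have hi' := Finset.mem_filter.1 hi
    exact ⟨(hs.mem i hi'.1).1, hi'.2.le⟩
  · exact hs.gap i (Finset.mem_filter.1 hi).1 j (Finset.mem_filter.1 hj).1
  · exact Finset.coe_subset.2 (Finset.filter_subset _ _)

lemma WellSpaced.upper {g : ℝ} {s : Input n} (hs : WellSpaced g s) {v : ℝ} (hav : s.a < v)
    (hvb : v < s.b) : WellSpaced g (Input.upper (s, v)) := by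
  refine ⟨hvb, ?_, fun i hi => ?_, fun i hi j hj => ?_, hs.injOn.mono ?_⟩
  · have := hs.length_le
    show s.b - v ≤ 1
    linarith
  · have hi' := Finset.mem_filter.1 hi
    exact ⟨hi'.2.le, (hs.mem i hi'.1).2⟩
  · exact hs.gap i (Finset.mem_filter.1 hi).1 j (Finset.mem_filter.1 hj).1
  · exact Finset.coe_subset.2 (Finset.filter_subset _ _)

lemma rank_lower (s : Input n) {v y : ℝ} (hy : y ≤ v) :
    rank s.x (Input.lower (s, v)).S y = rank s.x s.S y := by
  unfold rank
  congr 1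
  ext i
  simp only [Finset.mem_filter, mem_lower]
  exact ⟨fun h => ⟨h.1.1, h.2⟩, fun h => ⟨⟨h.1, h.2.trans_le hy⟩, h.2⟩⟩

lemma card_upper_add (s : Input n) {v : ℝ} (hv : ∀ i, s.x i ≠ v) :
    (Input.upper (s, v)).S.card + rank s.x s.S v = s.S.card := by
  unfold rank
  rw [add_comm, ← Finset.card_filter_add_card_filter_not (s := s.S) (fun i => s.x i < v)]
  congr 2
  ext i
  simp only [mem_upper, Finset.mem_filter, not_lt, and_congr_right_iff]
  exact fun _ => ⟨le_of_lt, fun h => lt_of_le_of_ne h (hv i).symm⟩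

lemma rank_upper_add (s : Input n) {v y : ℝ} (hv : ∀ i, s.x i ≠ v) (hy : v ≤ y) :
    rank s.x (Input.upper (s, v)).S y + rank s.x s.S v = rank s.x s.S y := by
  unfold rank
  rw [add_comm, ← Finset.card_filter_add_card_filter_not (s := {i ∈ s.S | s.x i < y})
    (fun i => s.x i < v), Finset.filter_filter, Finset.filter_filter]
  congr 2
  · ext i
    simp only [Finset.mem_filter, and_congr_right_iff]
    exact fun _ => ⟨fun h => ⟨h.trans_le hy, h⟩, fun h => h.2⟩
  · ext i
    simp only [mem_upper, Finset.mem_filter, not_lt]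
    exact ⟨fun h => ⟨h.1.1, h.2, h.1.2.le⟩,
      fun h => ⟨⟨h.1, lt_of_le_of_ne h.2.2 (hv i).symm⟩, h.2.1⟩⟩

/-- The outputs that lie in the output interval and whose ranks are within `r` of the ideal
values `N pᵢ`. -/
def accurate {m : ℕ} (r : ℝ) (p : Fin m → ℝ) (s : Input n) : Set (Fin m → ℝ) :=
  {q | ∀ i, s.a ≤ q i ∧ q i ≤ s.b ∧ |(rank s.x s.S (q i) : ℝ) - s.S.card * p i| ≤ r}

lemma measurableSet_accurate {m : ℕ} (r : ℝ) (p : Fin m → ℝ) (s : Input n) :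
    MeasurableSet (accurate r p s) := by
  have hrank := measurable_rank s.x s.S
  simp only [accurate, Set.ofPred_forall]
  refine MeasurableSet.iInter fun i => ?_
  have h : Measurable fun q : Fin m → ℝ => |(rank s.x s.S (q i) : ℝ) - s.S.card * p i| :=
    continuous_abs.measurable.comp ((hrank.comp (measurable_pi_apply i)).sub measurable_const)
  exact (measurableSet_le measurable_const (measurable_pi_apply i)).inter
    ((measurableSet_le (measurable_pi_apply i) measurable_const).inter
      (measurableSet_le h measurable_const))

/-- An error `e` in the rank of the median order `p_c` enters the ranks of the other orders by
linear interpolation with the exact ranks of the endpoints, hence with a factor at most `1`: the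
errors of successive levels add up. -/
lemma join_mem_accurate {k : ℕ} {p : Fin (k + 1) → ℝ} (hp : StrictMono p) (hp0 : ∀ i, 0 < p i)
    (hp1 : ∀ i, p i < 1) {s : Input n} {v r τ : ℝ} (hav : s.a < v) (hvb : v < s.b)
    (hr : 0 ≤ r) (hv : ∀ i, s.x i ≠ v)
    (hτ : |(rank s.x s.S v : ℝ) - s.S.card * p ⟨k / 2, by omega⟩| ≤ τ)
    {l : Fin (k / 2) → ℝ} {u : Fin (k - k / 2) → ℝ}
    (hl : l ∈ accurate r (fun j => p ⟨j.val, by omega⟩ / p ⟨k / 2, by omega⟩)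
      (Input.lower (s, v)))
    (hu : u ∈ accurate r (fun j => (p ⟨k / 2 + 1 + j.val, by omega⟩ - p ⟨k / 2, by omega⟩) /
      (1 - p ⟨k / 2, by omega⟩)) (Input.upper (s, v))) :
    join k (v, l, u) ∈ accurate (r + τ) p s := by
  intro i
  set c : ℝ := p ⟨k / 2, by omega⟩ with hc
  have hc0 : 0 < c := hp0 _
  have hc1 : 0 < 1 - c := sub_pos.2 (hp1 _)
  set e : ℝ := (rank s.x s.S v : ℝ) - s.S.card * c with he
  have hτ0 : 0 ≤ τ := (abs_nonneg _).trans hτ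
  have hcontract : ∀ w : ℝ, 0 ≤ w → w ≤ 1 → |e * w| ≤ τ := fun w hw0 hw1 => by
    rw [abs_mul, abs_of_nonneg hw0]
    exact (mul_le_of_le_one_right (abs_nonneg _) hw1).trans hτ
  unfold join
  split_ifs with h1 h2
  · obtain ⟨ha, hb, hrk⟩ := hl ⟨i.val, h1⟩
    have hpi : p i < c := hp h1
    refine ⟨ha, hb.trans hvb.le, ?_⟩
    have hb' : l ⟨i.val, h1⟩ ≤ v := hb
    have hrk' : |(rank s.x s.S (l ⟨i.val, h1⟩) : ℝ) - rank s.x s.S v * (p i / c)| ≤ r := by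
      rw [← rank_lower s hb']; exact hrk
    have hw := hcontract (p i / c) (div_nonneg (hp0 i).le hc0.le) ((div_le_one hc0).2 hpi.le)
    have heq : (rank s.x s.S (l ⟨i.val, h1⟩) : ℝ) - s.S.card * p i =
        ((rank s.x s.S (l ⟨i.val, h1⟩) : ℝ) - rank s.x s.S v * (p i / c)) + e * (p i / c) := by
      rw [he]; field_simp; ring
    rw [heq]
    exact (abs_add_le _ _).trans (add_le_add hrk' hw)
  · obtain ⟨ha, hb, hrk⟩ := hu ⟨i.val - (k / 2 + 1), by omega⟩
    set y := u ⟨i.val - (k / 2 + 1), by omega⟩ with hy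
    have hpi : c < p i := hp h2
    have hii : (⟨k / 2 + 1 + (i.val - (k / 2 + 1)), by omega⟩ : Fin (k + 1)) = i := by
      ext; simp only; omega
    refine ⟨hav.le.trans ha, hb, ?_⟩
    have hvy : v ≤ y := ha
    have hrk' : |(rank s.x (Input.upper (s, v)).S y : ℝ) -
        (Input.upper (s, v)).S.card * ((p i - c) / (1 - c))| ≤ r := by
      have := hrk
      simp only [hii] at this
      exact this
    have hcard : ((Input.upper (s, v)).S.card : ℝ) = s.S.card - rank s.x s.S v := by
      rw [← card_upper_add s hv]; push_cast; ring
    have hrank : (rank s.x s.S y : ℝ) = rank s.x (Input.upper (s, v)).S y + rank s.x s.S v := by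
      rw [← rank_upper_add s hv hvy]; push_cast; ring
    rw [hcard] at hrk'
    have hw := hcontract (1 - (p i - c) / (1 - c))
      (sub_nonneg.2 ((div_le_one hc1).2 (by linarith [hp1 i])))
      (sub_le_self _ (div_nonneg (by linarith) hc1.le))
    have heq : (rank s.x s.S y : ℝ) - s.S.card * p i =
        ((rank s.x (Input.upper (s, v)).S y : ℝ) -
          (s.S.card - rank s.x s.S v) * ((p i - c) / (1 - c))) +
          e * (1 - (p i - c) / (1 - c)) := by
      rw [he, hrank]; field_simp; ring
    show |(rank s.x s.S y : ℝ) - s.S.card * p i| ≤ r + τ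
    rw [heq]
    exact (abs_add_le _ _).trans (add_le_add hrk' hw)
  · have hii : i = ⟨k / 2, by omega⟩ := by ext; simp only; omega
    refine ⟨hav.le, hvb.le, ?_⟩
    rw [hii]
    exact hτ.trans (by linarith)

/-- Accuracy of the recursion of depth at most `d`: a union bound over the `m` calls of QExp. -/
lemma recursion_accurate_compl_le {ε g t : ℝ} (hε : 0 ≤ ε) (hg : 0 < g) (ht : 0 ≤ t) :
    ∀ (d m : ℕ), m < 2 ^ d → ∀ p : Fin m → ℝ, StrictMono p → (∀ i, 0 < p i) → (∀ i, p i < 1) →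
      ∀ s : Input n, WellSpaced g s →
        recursion ε m p s (accurate (d * (t + 1)) p s)ᶜ ≤
          m * ENNReal.ofReal (Real.exp (-(ε * t / 2)) / g) := by
  intro d
  induction d with
  | zero =>
    intro m hm p _ _ _ s _
    obtain rfl : m = 0 := by omega
    have : (accurate ((0 : ℕ) * (t + 1)) p s)ᶜ = ∅ := by
      ext q; simp [accurate]
    rw [this]; simp
  | succ d ih =>
    intro m hm p hp hp0 hp1 s hs
    rcases m with _ | k
    · have : (accurate ((d + 1 : ℕ) * (t + 1)) p s)ᶜ = ∅ := by
        ext q; simp [accurate]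
      rw [this]; simp
    set c : ℝ := p ⟨k / 2, by omega⟩ with hc
    have hc0 : 0 < c := hp0 _
    have hc1 : 0 < 1 - c := sub_pos.2 (hp1 _)
    set η := ENNReal.ofReal (Real.exp (-(ε * t / 2)) / g) with hη
    set pl : Fin (k / 2) → ℝ := fun j => p ⟨j.val, by omega⟩ / c with hpl
    set pu : Fin (k - k / 2) → ℝ := fun j => (p ⟨k / 2 + 1 + j.val, by omega⟩ - c) / (1 - c)
      with hpu
    have hk : k + 1 < 2 * 2 ^ d := by rw [pow_succ] at hm; omega
    have hl : ∀ s' : Input n, WellSpaced g s' →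
        recursion ε (k / 2) pl s' (accurate (d * (t + 1)) pl s')ᶜ ≤ (k / 2 : ℕ) * η := by
      refine ih (k / 2) (by omega) pl (fun i j hij => ?_) (fun i => div_pos (hp0 _) hc0)
        (fun i => (div_lt_one hc0).2 (hp ?_))
      · exact div_lt_div_of_pos_right (hp (Fin.mk_lt_mk.2 hij)) hc0
      · exact Fin.mk_lt_mk.2 i.2
    have hu : ∀ s' : Input n, WellSpaced g s' →
        recursion ε (k - k / 2) pu s' (accurate (d * (t + 1)) pu s')ᶜ ≤
          (k - k / 2 : ℕ) * η := by
      refine ih (k - k / 2) (by omega) pu (fun i j hij => ?_)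
        (fun i => div_pos (sub_pos.2 (hp ?_)) hc1)
        (fun i => (div_lt_one hc1).2 (sub_lt_sub_right (hp1 _) _))
      · refine div_lt_div_of_pos_right (sub_lt_sub_right (hp (Fin.mk_lt_mk.2 ?_)) _) hc1
        have : i.val < j.val := hij
        omega
      · exact Fin.mk_lt_mk.2 (by omega)
    set A := accurate ((d + 1 : ℕ) * (t + 1)) p s with hA
    have hAm : MeasurableSet Aᶜ := (measurableSet_accurate _ _ _).compl
    set B := {v | t + 1 < |(rank s.x s.S v : ℝ) - s.S.card * c|} with hB
    have hBle : qExp ε c s B ≤ η := qExp_rank_error_le hε hc0 (hp1 _) hg ht s hs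
    rw [recursion, Kernel.map_apply' _ (measurable_join k) _ hAm,
      Kernel.compProd_apply (measurable_join k hAm)]
    have hstep : ∀ᵐ v ∂qExp ε c s,
        ((recursion ε (k / 2) pl).comap Input.lower Input.measurable_lower ×ₖ
          (recursion ε (k - k / 2) pu).comap Input.upper Input.measurable_upper) (s, v)
            (Prod.mk v ⁻¹' (join k ⁻¹' Aᶜ)) ≤
          B.indicator 1 v + ((k / 2 : ℕ) * η + (k - k / 2 : ℕ) * η) := by
      filter_upwards [ae_qExp ε c s hs.lt] with v ⟨hav, hvb, hv⟩
      by_cases hvB : v ∈ B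
      · rw [Set.indicator_of_mem hvB]
        exact prob_le_one.trans (le_add_of_nonneg_right zero_le)
      · rw [Set.indicator_of_notMem hvB, zero_add, Kernel.prod_apply, Kernel.comap_apply,
          Kernel.comap_apply]
        set sl := Input.lower (s, v) with hsl
        set su := Input.upper (s, v) with hsu
        have hsub : Prod.mk v ⁻¹' (join k ⁻¹' Aᶜ) ⊆
            (accurate (d * (t + 1)) pl sl)ᶜ ×ˢ Set.univ ∪
              Set.univ ×ˢ (accurate (d * (t + 1)) pu su)ᶜ := by
          rintro ⟨l, u⟩ hlu
          by_contra hcon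
          simp only [Set.mem_union, Set.mem_prod, Set.mem_univ, and_true, true_and,
            Set.mem_compl_iff, not_or, not_not] at hcon
          refine hlu ?_
          have := join_mem_accurate hp hp0 hp1 hav hvb
            (show 0 ≤ (d : ℝ) * (t + 1) by positivity) hv (not_lt.1 hvB) hcon.1 hcon.2
          rwa [hA, show ((d + 1 : ℕ) : ℝ) * (t + 1) = d * (t + 1) + (t + 1) by push_cast; ring]
        refine (measure_mono hsub).trans ((measure_union_le _ _).trans ?_)
        rw [Measure.prod_prod, Measure.prod_prod, measure_univ, measure_univ, mul_one, one_mul]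
        exact add_le_add (hl _ (hs.lower hav hvb)) (hu _ (hs.upper hav hvb))
    refine (lintegral_mono_ae hstep).trans ?_
    rw [lintegral_add_right _ measurable_const, lintegral_const, measure_univ, mul_one]
    refine (add_le_add_left ((lintegral_indicator_one_le _).trans hBle) _).trans_eq ?_
    rw [← add_mul, ← Nat.cast_add, Nat.add_sub_cancel' (Nat.div_le_self k 2)]
    push_cast; ring

end

/-! ### The law of the sample -/

section

variable {f : ℝ → ℝ} {lo hi : ℝ}

lemma cdf_sub_cdf_ge [IsProbabilityMeasure (unitLaw f)] (hlo : 0 < lo)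
    (hbound : ∀ᵐ t ∂(volume.restrict (Set.Icc (0 : ℝ) 1)), lo ≤ f t ∧ f t ≤ hi)
    {z s : ℝ} (hz : 0 ≤ z) (hzs : z ≤ s) (hs : s ≤ 1) :
    lo * (s - z) ≤ cdf (unitLaw f) s - cdf (unitLaw f) z := by
  have h1 : ENNReal.ofReal (lo * (s - z)) ≤ unitLaw f (Set.Ioc z s) := by
    have hsub : Set.Ioc z s ⊆ Set.Icc 0 1 := fun t ht => ⟨hz.trans ht.1.le, ht.2.trans hs⟩
    rw [unitLaw, withDensity_apply _ measurableSet_Ioc,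
      Measure.restrict_restrict measurableSet_Ioc, Set.inter_eq_left.2 hsub]
    calc ENNReal.ofReal (lo * (s - z))
        = ∫⁻ _ in Set.Ioc z s, ENNReal.ofReal lo := by
          rw [setLIntegral_const, Real.volume_Ioc, ENNReal.ofReal_mul hlo.le]
      _ ≤ _ := by
          refine lintegral_mono_ae ?_
          filter_upwards [ae_restrict_of_ae_restrict_of_subset hsub hbound] with t ht
          exact ENNReal.ofReal_le_ofReal ht.1
  rw [← measure_cdf (unitLaw f), StieltjesFunction.measure_Ioc] at h1
  exact (ENNReal.ofReal_le_ofReal_iff (sub_nonneg.2 (monotone_cdf _ hzs))).1 h1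

lemma unitLaw_le (hbound : ∀ᵐ t ∂(volume.restrict (Set.Icc (0 : ℝ) 1)), lo ≤ f t ∧ f t ≤ hi)
    {A : Set ℝ} (hA : MeasurableSet A) : unitLaw f A ≤ ENNReal.ofReal hi * volume A := by
  rw [unitLaw, withDensity_apply _ hA]
  calc ∫⁻ t in A, ENNReal.ofReal (f t) ∂(volume.restrict (Set.Icc 0 1))
      ≤ ∫⁻ _ in A, ENNReal.ofReal hi ∂(volume.restrict (Set.Icc 0 1)) := by
        refine lintegral_mono_ae ?_
        filter_upwards [ae_restrict_of_ae hbound] with t ht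
        exact ENNReal.ofReal_le_ofReal ht.2
    _ ≤ ENNReal.ofReal hi * volume A := by
        rw [setLIntegral_const]
        gcongr
        exact Measure.restrict_le_self

lemma unitLaw_compl_Icc : unitLaw f (Set.Icc 0 1)ᶜ = 0 := by
  refine withDensity_absolutelyContinuous _ _ ?_
  rw [Measure.restrict_apply measurableSet_Icc.compl, Set.compl_inter_self, measure_empty]

lemma cdf_unitLaw_one [IsProbabilityMeasure (unitLaw f)] : cdf (unitLaw f) 1 = 1 := by
  have h : unitLaw f (Set.Iic 1)ᶜ = 0 :=
    measure_mono_null (Set.compl_subset_compl.2 fun _ ht => ht.2) (unitLaw_compl_Icc (f := f))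
  rw [cdf_eq_real, measureReal_def, (prob_compl_eq_zero_iff measurableSet_Iic).1 h,
    ENNReal.toReal_one]

lemma cdf_unitLaw_of_neg [IsProbabilityMeasure (unitLaw f)] {t : ℝ} (ht : t < 0) :
    cdf (unitLaw f) t = 0 := by
  rw [cdf_eq_real, measureReal_def, measure_mono_null _ (unitLaw_compl_Icc (f := f)),
    ENNReal.toReal_zero]
  exact fun s hs h => (lt_of_le_of_lt hs ht).not_ge h.1

section

variable [IsProbabilityMeasure (unitLaw f)] {p : ℝ}

lemma nonneg_of_le_cdf (hp0 : 0 < p) {t : ℝ} (ht : p ≤ cdf (unitLaw f) t) : 0 ≤ t := by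
  by_contra h
  rw [cdf_unitLaw_of_neg (not_le.1 h)] at ht
  exact ht.not_gt hp0

lemma quantile_nonneg (hp0 : 0 < p) : 0 ≤ quantile (unitLaw f) p :=
  Real.sInf_nonneg fun _ ht => nonneg_of_le_cdf hp0 ht

lemma quantile_le_of_le_cdf (hp0 : 0 < p) {t : ℝ} (ht : p ≤ cdf (unitLaw f) t) :
    quantile (unitLaw f) p ≤ t :=
  csInf_le ⟨0, fun _ hs => nonneg_of_le_cdf hp0 hs⟩ ht

lemma le_cdf_quantile (hp1 : p ≤ 1) :
    p ≤ cdf (unitLaw f) (quantile (unitLaw f) p) := by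
  set Q := quantile (unitLaw f) p with hQ
  have hne : {t | p ≤ cdf (unitLaw f) t}.Nonempty := ⟨1, by simpa [cdf_unitLaw_one] using hp1⟩
  have hcont : Filter.Tendsto (cdf (unitLaw f)) (nhdsWithin Q (Set.Ioi Q))
      (nhds (cdf (unitLaw f) Q)) :=
    ((cdf (unitLaw f)).right_continuous Q).mono_left (nhdsWithin_mono _ Set.Ioi_subset_Ici_self)
  refine ge_of_tendsto hcont ?_
  filter_upwards [self_mem_nhdsWithin] with t ht
  obtain ⟨s, hs, hst⟩ := exists_lt_of_csInf_lt hne (show sInf _ < t from ht)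
  exact le_trans hs (monotone_cdf _ hst.le)

end

lemma rank_univ_eq_sum {n : ℕ} (x : Fin n → ℝ) (v : ℝ) :
    (rank x Finset.univ v : ℝ) = ∑ i, (Set.Iio v).indicator (1 : ℝ → ℝ) (x i) := by
  simp [rank, Set.indicator_apply, Finset.sum_boole]

/-- If the fractions of the sample beyond `F⁻¹(p) + γ` and below `F⁻¹(p) - γ` do not exceed their
expectations by `lo γ / 4`, then a point of rank about `n p` is within `γ` of `F⁻¹(p)`: between
`F⁻¹(p)` and `F⁻¹(p) ± γ` the distribution function varies by at least `lo γ`. -/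
lemma abs_sub_quantile_le [IsProbabilityMeasure (unitLaw f)] {n : ℕ} (hn : 1 ≤ n) (hlo : 0 < lo)
    (hbound : ∀ᵐ t ∂(volume.restrict (Set.Icc (0 : ℝ) 1)), lo ≤ f t ∧ f t ≤ hi)
    {p γ ρ q : ℝ} (hp0 : 0 < p) (hp1 : p < 1) (hγ : 0 < γ) (x : Fin n → ℝ)
    (hq0 : 0 ≤ q) (hq1 : q ≤ 1) (hρ : ρ < 3 / 4 * (n * γ * lo))
    (hrank : |(rank x Finset.univ q : ℝ) - n * p| ≤ ρ)
    (hright : ∑ i, (Set.Ioi (quantile (unitLaw f) p + γ)).indicator (1 : ℝ → ℝ) (x i) <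
      n * ((unitLaw f).real (Set.Ioi (quantile (unitLaw f) p + γ)) + γ * lo / 4))
    (hleft : ∑ i, (Set.Iic (quantile (unitLaw f) p - γ)).indicator (1 : ℝ → ℝ) (x i) <
      n * ((unitLaw f).real (Set.Iic (quantile (unitLaw f) p - γ)) + γ * lo / 4)) :
    |q - quantile (unitLaw f) p| ≤ γ := by
  have hn0 : (0 : ℝ) < n := by exact_mod_cast hn
  have hQ0 := quantile_nonneg (f := f) hp0
  have hQ1 : quantile (unitLaw f) p ≤ 1 :=
    quantile_le_of_le_cdf hp0 (by rw [cdf_unitLaw_one]; exact hp1.le)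
  have hQp := le_cdf_quantile (f := f) hp1.le
  have hQlt : ∀ s, s < quantile (unitLaw f) p → cdf (unitLaw f) s < p := fun s hs => by
    by_contra h
    exact (quantile_le_of_le_cdf hp0 (not_lt.1 h)).not_gt hs
  set Q := quantile (unitLaw f) p with hQ
  rw [rank_univ_eq_sum] at hrank
  obtain ⟨hr1, hr2⟩ := abs_le.1 hrank
  rw [abs_le]
  constructor
  · by_contra hcon
    push Not at hcon
    have hsum : ∑ i, (Set.Iio q).indicator (1 : ℝ → ℝ) (x i) ≤
        ∑ i, (Set.Iic (Q - γ)).indicator (1 : ℝ → ℝ) (x i) :=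
      Finset.sum_le_sum fun i _ =>
        Set.indicator_le_indicator_of_subset (fun t ht => by
          have ht' : t < q := ht
          show t ≤ Q - γ
          linarith) (fun _ => zero_le_one) _
    have hF : cdf (unitLaw f) (Q - γ) ≤ p - lo * γ := by
      refine le_of_forall_pos_le_add fun δ hδ => ?_
      -- `F (F⁻¹(p)) ≤ p` needs continuity of `F`; points slightly to the left of `F⁻¹(p)` avoid it.
      set s := max (Q - γ) (Q - δ / lo) with hs
      have hsQ : s < Q := max_lt (by linarith) (by have := div_pos hδ hlo; linarith)
      have h1 := cdf_sub_cdf_ge hlo hbound (show 0 ≤ Q - γ by linarith) (le_max_left _ _)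
        (hsQ.le.trans hQ1)
      have h2 := hQlt s hsQ
      have h3 : lo * (Q - δ / lo) ≤ lo * s := mul_le_mul_of_nonneg_left (le_max_right _ _) hlo.le
      have h4 : lo * (Q - δ / lo) = lo * Q - δ := by field_simp
      rw [← hs] at h1
      nlinarith
    rw [← cdf_eq_real] at hleft
    nlinarith
  · by_contra hcon
    push Not at hcon
    have hsum : (n : ℝ) ≤ ∑ i, (Set.Iio q).indicator (1 : ℝ → ℝ) (x i) +
        ∑ i, (Set.Ioi (Q + γ)).indicator (1 : ℝ → ℝ) (x i) := by
      rw [← Finset.sum_add_distrib]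
      calc (n : ℝ) = ∑ _i : Fin n, (1 : ℝ) := by simp
        _ ≤ _ := Finset.sum_le_sum fun i _ => by
          by_cases h : x i < q
          · rw [Set.indicator_of_mem (show x i ∈ Set.Iio q from h)]
            exact le_add_of_nonneg_right (Set.indicator_nonneg (fun _ _ => zero_le_one) _)
          · rw [Set.indicator_of_mem (show x i ∈ Set.Ioi (Q + γ) from by
              show Q + γ < x i
              linarith)]
            exact le_add_of_nonneg_left (Set.indicator_nonneg (fun _ _ => zero_le_one) _)
    have h1 := cdf_sub_cdf_ge hlo hbound hQ0 (show Q ≤ Q + γ by linarith) (by linarith)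
    have h2 : (unitLaw f).real (Set.Ioi (Q + γ)) = 1 - cdf (unitLaw f) (Q + γ) := by
      rw [cdf_eq_real, ← Set.compl_Iic, probReal_compl_eq_one_sub measurableSet_Iic]
    rw [h2] at hright
    nlinarith

variable {Ω : Type*} [MeasurableSpace Ω] {P : Measure Ω} [IsProbabilityMeasure P]

/-- Hoeffding's inequality for the number of sample points in `A`. -/
lemma measure_count_ge_le {n : ℕ} (hn : 1 ≤ n) {X : Fin n → Ω → ℝ} (hX : ∀ i, Measurable (X i))
    (hindep : iIndepFun X P) {μ : Measure ℝ} (hlaw : ∀ i, P.map (X i) = μ) {A : Set ℝ}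
    (hA : MeasurableSet A) {δ : ℝ} (hδ : 0 ≤ δ) :
    P.real {ω | n * (μ.real A + δ) ≤ ∑ i, A.indicator (1 : ℝ → ℝ) (X i ω)} ≤
      Real.exp (-(2 * n * δ ^ 2)) := by
  have hn0 : (0 : ℝ) < n := by exact_mod_cast hn
  have hmean : ∀ i, P[fun ω => A.indicator (1 : ℝ → ℝ) (X i ω)] = μ.real A := fun i => by
    rw [← hlaw i, ← integral_map (f := A.indicator (1 : ℝ → ℝ)) (hX i).aemeasurable
      ((measurable_one.indicator hA).aestronglyMeasurable), integral_indicator_one hA]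
  have hind : iIndepFun (fun i ω => A.indicator (1 : ℝ → ℝ) (X i ω) - μ.real A) P :=
    hindep.comp (fun _ t => A.indicator (1 : ℝ → ℝ) t - μ.real A)
      (fun _ => (measurable_one.indicator hA).sub_const _)
  have hsub : ∀ i ∈ (Finset.univ : Finset (Fin n)),
      HasSubgaussianMGF (fun ω => A.indicator (1 : ℝ → ℝ) (X i ω) - μ.real A)
        ((‖(1 : ℝ) - 0‖₊ / 2) ^ 2) P := fun i _ => by
    have := hasSubgaussianMGF_of_mem_Icc (μ := P) (a := 0) (b := 1)
      (X := fun ω => A.indicator (1 : ℝ → ℝ) (X i ω))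
      ((measurable_one.indicator hA).comp (hX i)).aemeasurable
      (ae_of_all _ fun ω => ⟨Set.indicator_nonneg (fun _ _ => zero_le_one) _,
        Set.indicator_le_self' (fun _ _ => zero_le_one) _⟩)
    rwa [hmean i] at this
  have h := HasSubgaussianMGF.measure_sum_ge_le_of_iIndepFun hind hsub
    (show 0 ≤ n * δ by positivity)
  have hset : {ω | n * (μ.real A + δ) ≤ ∑ i, A.indicator (1 : ℝ → ℝ) (X i ω)} =
      {ω | n * δ ≤ ∑ i, (A.indicator (1 : ℝ → ℝ) (X i ω) - μ.real A)} := by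
    ext ω
    simp only [Set.mem_ofPred_eq, Finset.sum_sub_distrib, Finset.sum_const, Finset.card_univ,
      Fintype.card_fin, nsmul_eq_mul]
    constructor <;> intro h <;> linarith
  rw [hset]
  refine h.trans_eq ?_
  congr 1
  simp
  field_simp

/-- Two independent sample points are rarely closer than `g`. -/
lemma measure_abs_sub_lt_le {Y Z : Ω → ℝ} (hY : Measurable Y) (hZ : Measurable Z)
    (hYZ : IndepFun Y Z P) (hYlaw : P.map Y = unitLaw f) (hZlaw : P.map Z = unitLaw f)
    (hbound : ∀ᵐ t ∂(volume.restrict (Set.Icc (0 : ℝ) 1)), lo ≤ f t ∧ f t ≤ hi) (hhi : 0 ≤ hi)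
    (g : ℝ) : P {ω | |Y ω - Z ω| < g} ≤ ENNReal.ofReal (2 * g * hi) := by
  have : IsProbabilityMeasure (unitLaw f) := hYlaw ▸ Measure.isProbabilityMeasure_map hY.aemeasurable
  have hmap : P.map (fun ω => (Y ω, Z ω)) = (unitLaw f).prod (unitLaw f) := by
    rw [(indepFun_iff_map_prod_eq_prod_map_map hY.aemeasurable hZ.aemeasurable).1 hYZ, hYlaw, hZlaw]
  have hm : MeasurableSet {t : ℝ × ℝ | |t.1 - t.2| < g} :=
    measurableSet_lt (by fun_prop) measurable_const
  have heq : P {ω | |Y ω - Z ω| < g} = (unitLaw f).prod (unitLaw f) {t | |t.1 - t.2| < g} := by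
    rw [← hmap, Measure.map_apply (hY.prodMk hZ) hm]; rfl
  rw [heq, Measure.prod_apply hm]
  calc ∫⁻ y, unitLaw f (Prod.mk y ⁻¹' {t | |t.1 - t.2| < g}) ∂unitLaw f
      ≤ ∫⁻ _, ENNReal.ofReal (2 * g * hi) ∂unitLaw f := by
        refine lintegral_mono fun y => ?_
        have hball : Prod.mk y ⁻¹' {t : ℝ × ℝ | |t.1 - t.2| < g} = Metric.ball y g := by
          ext z
          simp [Real.dist_eq, abs_sub_comm y z]
        rw [hball]
        refine (unitLaw_le hbound measurableSet_ball).trans_eq ?_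
        rw [Real.volume_ball, ← ENNReal.ofReal_mul hhi]
        congr 1; ring
    _ = _ := by rw [lintegral_const, measure_univ, mul_one]

end

/-! ### Utility of RecExp -/

section

variable {n m : ℕ}

/-- On a sample that is well spread and whose empirical distribution is close to the law at the
points `F⁻¹(pᵢ) ± γ`, RecExp fails only if some call of QExp does. -/
lemma recExp_le {f : ℝ → ℝ} {lo hi : ℝ} [IsProbabilityMeasure (unitLaw f)] (hn : 1 ≤ n)
    (hlo : 0 < lo)
    (hbound : ∀ᵐ t ∂(volume.restrict (Set.Icc (0 : ℝ) 1)), lo ≤ f t ∧ f t ≤ hi)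
    {ε γ g t : ℝ} (hε : 0 ≤ ε) (hγ : 0 < γ) (hg : 0 < g) (ht : 0 ≤ t)
    {p : Fin m → ℝ} (hmono : StrictMono p) (hp0 : ∀ i, 0 < p i) (hp1 : ∀ i, p i < 1)
    (hm : 1 ≤ m) (hL : (Real.logb 2 m + 1) * (t + 1) < 3 / 4 * (n * γ * lo))
    (x : Fin n → ℝ) (hx : ∀ i, x i ∈ Set.Icc (0 : ℝ) 1)
    (hgap : ∀ i j, i ≠ j → g ≤ |x i - x j|)
    (hright : ∀ k, ∑ i, (Set.Ioi (quantile (unitLaw f) (p k) + γ)).indicator (1 : ℝ → ℝ) (x i) <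
      n * ((unitLaw f).real (Set.Ioi (quantile (unitLaw f) (p k) + γ)) + γ * lo / 4))
    (hleft : ∀ k, ∑ i, (Set.Iic (quantile (unitLaw f) (p k) - γ)).indicator (1 : ℝ → ℝ) (x i) <
      n * ((unitLaw f).real (Set.Iic (quantile (unitLaw f) (p k) - γ)) + γ * lo / 4)) :
    recExp ε p x {q | γ < ‖q - fun i => quantile (unitLaw f) (p i)‖} ≤
      m * ENNReal.ofReal (Real.exp (-(ε / (Real.logb 2 m + 1) * t / 2)) / g) := by
  have hspaced : WellSpaced g (Input.root x) := by
    refine ⟨zero_lt_one, by simp [Input.root], fun i _ => hx i, fun i _ j _ hij => ?_,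
      fun i _ j _ hij => ?_⟩
    · have hij' : x i < x j := hij
      have := hgap j i fun h => by rw [h] at hij'; exact lt_irrefl _ hij'
      rwa [abs_of_pos (sub_pos.2 hij')] at this
    · by_contra hne
      have hij' : x i = x j := hij
      have := hgap i j hne
      rw [hij', sub_self, abs_zero] at this
      linarith
  have hlog : 0 ≤ Real.logb 2 m := Real.logb_nonneg one_lt_two (by exact_mod_cast hm)
  have hrec := recursion_accurate_compl_le (ε := ε / (Real.logb 2 m + 1)) (by positivity) hg ht
    (Nat.log 2 m + 1) m (Nat.lt_pow_succ_log_self one_lt_two m) p hmono hp0 hp1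
    (Input.root x) hspaced
  rw [recExp, Kernel.comap_apply]
  refine (measure_mono fun q hq hacc => ?_).trans hrec
  refine (not_le.2 hq) ((pi_norm_le_iff_of_nonneg hγ.le).2 fun k => ?_)
  obtain ⟨h0, h1, hr⟩ := hacc k
  have hcard : ((Input.root x).S.card : ℝ) = n := by
    show ((Finset.univ : Finset (Fin n)).card : ℝ) = n
    simp
  rw [hcard] at hr
  refine abs_sub_quantile_le hn hlo hbound (hp0 k) (hp1 k) hγ x h0 h1 (lt_of_le_of_lt ?_ hL) hr
    (hright k) (hleft k)
  push_cast
  gcongr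
  exact Real.natLog_le_logb m 2

end

/-- The claimed bound is at least `1`, unless the number `D = n γ lo` of sample points that are
expected near a quantile is large compared with the depth of the recursion. -/
lemma one_le_of_le_logb {m : ℕ} (hm : 1 ≤ m) {D c : ℝ} (hD : D * (5 / 8) ≤ Real.logb 2 (2 * m))
    (hc : c ≤ D / 8) : 1 ≤ 4 * m * Real.exp (-c) := by
  have hm' : (1 : ℝ) ≤ m := by exact_mod_cast hm
  have hlog2 := Real.log_two_gt_d9
  have hL : Real.logb 2 (2 * m) * Real.log 2 = Real.log (2 * m) := by
    rw [Real.logb, div_mul_cancel₀]; linarith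
  have hL0 : 0 ≤ Real.logb 2 (2 * m) := Real.logb_nonneg one_lt_two (by linarith)
  have h1 : c ≤ Real.log (2 * m) := by rw [← hL]; nlinarith
  have h2 : Real.exp c ≤ 2 * m := by
    rw [← Real.exp_log (show (0 : ℝ) < 2 * m by linarith)]
    exact Real.exp_le_exp.2 h1
  rw [Real.exp_neg, ← div_eq_mul_inv, one_le_div (Real.exp_pos c)]
  linarith

end PrivateQuantile

open PrivateQuantile

theorem mainTheorem1
    {Ω : Type*} [MeasurableSpace Ω] (P : Measure Ω) [IsProbabilityMeasure P]
    (n m : ℕ) (hn : 1 ≤ n) (hm : 1 ≤ m)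
    -- the density and its bounds
    (f : ℝ → ℝ) (hf : Measurable f) (lo hi : ℝ) (hlo : 0 < lo)
    (hbound : ∀ᵐ t ∂(volume.restrict (Set.Icc (0 : ℝ) 1)), lo ≤ f t ∧ f t ≤ hi)
    (hdens : ∫ t in Set.Icc (0 : ℝ) 1, f t = 1)
    -- the i.i.d. sample
    (X : Fin n → Ω → ℝ) (hX : ∀ i, Measurable (X i)) (hindep : iIndepFun X P)
    (hlaw : ∀ i, P.map (X i) = PrivateQuantile.unitLaw f)
    -- the privacy budget and the orders
    (ε : ℝ) (hε : 0 < ε)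
    (p : Fin m → ℝ) (hmono : StrictMono p)
    (hp : ∀ i, 2 / (n : ℝ) < min (p i) (1 - p i))
    -- the output of RecExp on the sample: its law given the sample is that of the mechanism
    (q : Ω → Fin m → ℝ) (hq : Measurable q)
    (hrec : P.map (fun ω => (fun i => X i ω, q ω)) =
      (P.map fun ω i => X i ω) ⊗ₘ PrivateQuantile.recExp ε p)
    (γ : ℝ) (hγ : 0 < γ) (hγp : ∀ i, γ < 2 * min (p i) (1 - p i) / lo) :
    P.real {ω | γ < ‖q ω - fun i => PrivateQuantile.quantile (PrivateQuantile.unitLaw f) (p i)‖} ≤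
      4 * n * Real.sqrt (2 * Real.exp 1 * hi * m) *
          Real.exp (-(ε * n * γ * lo / (32 * Real.logb 2 (2 * m) ^ 2))) +
        4 * m * Real.exp (-(γ ^ 2 * lo ^ 2 / 8 * n)) := by
  have hn0 : (0 : ℝ) < n := by exact_mod_cast hn
  have hm1 : (1 : ℝ) ≤ m := by exact_mod_cast hm
  have hmin : ∀ i, 0 < min (p i) (1 - p i) := fun i => lt_trans (by positivity) (hp i)
  have hp0 : ∀ i, 0 < p i := fun i => (lt_min_iff.1 (hmin i)).1
  have hp1 : ∀ i, p i < 1 := fun i => sub_pos.1 (lt_min_iff.1 (hmin i)).2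
  have hγlo : γ * lo ≤ 1 := by
    have h := (lt_div_iff₀ hlo).1 (hγp ⟨0, hm⟩)
    have h1 := min_le_left (p ⟨0, hm⟩) (1 - p ⟨0, hm⟩)
    have h2 := min_le_right (p ⟨0, hm⟩) (1 - p ⟨0, hm⟩)
    linarith
  have : IsProbabilityMeasure (unitLaw f) :=
    hlaw ⟨0, hn⟩ ▸ Measure.isProbabilityMeasure_map (hX _).aemeasurable
  have hhi : 0 < hi := by
    have : (ae (volume.restrict (Set.Icc (0 : ℝ) 1))).NeBot := by
      rw [ae_neBot, Ne, Measure.restrict_eq_zero, Real.volume_Icc]; simp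
    obtain ⟨t, ht⟩ := hbound.exists
    exact hlo.trans_le (ht.1.trans ht.2)
  set L := Real.logb 2 (2 * m) with hLdef
  have hL : Real.logb 2 m + 1 = L := by
    rw [hLdef, Real.logb_mul two_ne_zero (by linarith), Real.logb_self_eq_one one_lt_two, add_comm]
  have hL1 : 1 ≤ L := by
    rw [← hL]; linarith [Real.logb_nonneg one_lt_two hm1]
  set D := n * γ * lo with hD
  have hD0 : 0 < D := by positivity
  rcases le_or_gt (D * (5 / 8)) L with hDL | hDL
  · have h1 : γ ^ 2 * lo ^ 2 / 8 * n ≤ D / 8 := by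
      have : γ ^ 2 * lo ^ 2 / 8 * n = D / 8 * (γ * lo) := by rw [hD]; ring
      rw [this]
      exact mul_le_of_le_one_right (by positivity) hγlo
    exact measureReal_le_one.trans ((one_le_of_le_logb hm hDL h1).trans
      (le_add_of_nonneg_left (by positivity)))
  set Q : Fin m → ℝ := fun i => quantile (unitLaw f) (p i) with hQ
  -- The rank error allowed to each call of QExp; `L` levels use up `D / 8 + L`.
  set t := D / (8 * L) with ht
  have ht0 : 0 ≤ t := by positivity
  have hLt : (Real.logb 2 m + 1) * (t + 1) < 3 / 4 * (n * γ * lo) := by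
    have : L * (t + 1) = D / 8 + L := by rw [ht]; field_simp
    rw [hL, this, ← hD]; linarith
  set E := Real.exp (-(ε * n * γ * lo / (32 * L ^ 2))) with hE
  have hE0 : 0 < E := Real.exp_pos _
  have hEE : Real.exp (-(ε / (Real.logb 2 m + 1) * t / 2)) = E * E := by
    rw [hE, ← Real.exp_add, hL, ht, hD]
    congr 1
    field_simp
    ring
  set r := Real.sqrt (2 * hi * m) with hr
  have hr0 : 0 < r := Real.sqrt_pos.2 (by positivity)
  have hrr : r * r = 2 * hi * m := Real.mul_self_sqrt (by positivity)
  -- The separation for which the probabilities that two points are closer, and that some call of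
  -- QExp fails, have the same bound `n r E`.
  set g := r * E / (2 * hi * n) with hg
  have hg0 : 0 < g := by positivity
  set H := Real.exp (-(γ ^ 2 * lo ^ 2 / 8 * n)) with hH
  set Wgap : Set Ω := ⋃ ij ∈ (Finset.univ : Finset (Fin n × Fin n)).filter (fun ij => ij.1 ≠ ij.2),
    {ω | |X ij.1 ω - X ij.2 ω| < g} with hWgap
  set R : Fin m → Set Ω := fun k => {ω | n * ((unitLaw f).real (Set.Ioi (Q k + γ)) + γ * lo / 4) ≤
    ∑ i, (Set.Ioi (Q k + γ)).indicator (1 : ℝ → ℝ) (X i ω)} with hR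
  set T : Fin m → Set Ω := fun k => {ω | n * ((unitLaw f).real (Set.Iic (Q k - γ)) + γ * lo / 4) ≤
    ∑ i, (Set.Iic (Q k - γ)).indicator (1 : ℝ → ℝ) (X i ω)} with hT
  have hPgap : P Wgap ≤ ENNReal.ofReal (n * r * E) := by
    calc P Wgap ≤ ∑ ij ∈ (Finset.univ : Finset (Fin n × Fin n)).filter (fun ij => ij.1 ≠ ij.2),
          P {ω | |X ij.1 ω - X ij.2 ω| < g} := measure_biUnion_finset_le _ _
      _ ≤ ∑ ij ∈ (Finset.univ : Finset (Fin n × Fin n)).filter (fun ij => ij.1 ≠ ij.2),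
          ENNReal.ofReal (2 * g * hi) := Finset.sum_le_sum fun ij hij =>
            measure_abs_sub_lt_le (hX _) (hX _) (hindep.indepFun (Finset.mem_filter.1 hij).2)
              (hlaw _) (hlaw _) hbound hhi.le g
      _ ≤ ∑ _ij : Fin n × Fin n, ENNReal.ofReal (2 * g * hi) :=
          Finset.sum_le_sum_of_subset (Finset.filter_subset _ _)
      _ = ENNReal.ofReal (n * r * E) := by
          rw [Finset.sum_const, nsmul_eq_mul, ← ENNReal.ofReal_natCast,
            ← ENNReal.ofReal_mul (by positivity)]
          congr 1
          simp only [Finset.card_univ, Fintype.card_prod, Fintype.card_fin, Nat.cast_mul, hg]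
          field_simp
  have hexp : ∀ A : Set ℝ, MeasurableSet A → P {ω | n * ((unitLaw f).real A + γ * lo / 4) ≤
      ∑ i, A.indicator (1 : ℝ → ℝ) (X i ω)} ≤ ENNReal.ofReal H := fun A hA => by
    rw [← ofReal_measureReal]
    refine ENNReal.ofReal_le_ofReal
      ((measure_count_ge_le hn hX hindep hlaw hA (by positivity)).trans_eq ?_)
    rw [hH]; congr 1; ring
  have hunion : ∀ S : Fin m → Set Ω, (∀ k, P (S k) ≤ ENNReal.ofReal H) →
      P (⋃ k, S k) ≤ ENNReal.ofReal (m * H) := fun S hS => by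
    refine (measure_iUnion_fintype_le P S).trans ((Finset.sum_le_sum fun k _ => hS k).trans_eq ?_)
    rw [Finset.sum_const, nsmul_eq_mul, Finset.card_univ, Fintype.card_fin,
      ENNReal.ofReal_mul (by positivity), ENNReal.ofReal_natCast]
  set c : ℝ≥0∞ := m * ENNReal.ofReal (Real.exp (-(ε / (Real.logb 2 m + 1) * t / 2)) / g) with hc
  have hceq : c = ENNReal.ofReal (n * r * E) := by
    rw [hc, hEE, ← ENNReal.ofReal_natCast, ← ENNReal.ofReal_mul (by positivity)]
    congr 1
    rw [hg]
    field_simp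
    linarith
  have hXm : Measurable fun ω i => X i ω := measurable_pi_lambda _ hX
  have hbad : MeasurableSet {t : (Fin n → ℝ) × (Fin m → ℝ) | γ < ‖t.2 - Q‖} :=
    measurableSet_lt measurable_const (by fun_prop)
  have hcond : P {ω | γ < ‖q ω - Q‖} =
      ∫⁻ ω, recExp ε p (fun i => X i ω) {q | γ < ‖q - Q‖} ∂P := by
    have h1 : P {ω | γ < ‖q ω - Q‖} = P.map (fun ω => (fun i => X i ω, q ω))
        {t : (Fin n → ℝ) × (Fin m → ℝ) | γ < ‖t.2 - Q‖} := by
      rw [Measure.map_apply (hXm.prodMk hq) hbad]; rfl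
    rw [h1, hrec, Measure.compProd_apply hbad,
      lintegral_map (Kernel.measurable_kernel_prodMk_left hbad) hXm]
    rfl
  have hmem : ∀ᵐ ω ∂P, ∀ i, X i ω ∈ Set.Icc (0 : ℝ) 1 := by
    refine ae_all_iff.2 fun i => ?_
    refine ae_of_ae_map (p := fun y => y ∈ Set.Icc (0 : ℝ) 1) (hX i).aemeasurable ?_
    rw [hlaw i]
    exact unitLaw_compl_Icc
  set W := Wgap ∪ ((⋃ k, R k) ∪ ⋃ k, T k) with hW
  have hPW : P {ω | γ < ‖q ω - Q‖} ≤ P W + c := by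
    rw [hcond]
    calc ∫⁻ ω, recExp ε p (fun i => X i ω) {q | γ < ‖q - Q‖} ∂P
        ≤ ∫⁻ ω, (W.indicator 1 ω + c) ∂P := by
          refine lintegral_mono_ae ?_
          filter_upwards [hmem] with ω hω
          by_cases hωW : ω ∈ W
          · rw [Set.indicator_of_mem hωW]
            exact prob_le_one.trans (le_add_of_nonneg_right zero_le)
          · rw [Set.indicator_of_notMem hωW, zero_add]
            rw [hW, Set.mem_union, Set.mem_union, not_or, not_or] at hωW
            obtain ⟨hW1, hW2, hW3⟩ := hωW
            refine recExp_le hn hlo hbound hε.le hγ hg0 ht0 hmono hp0 hp1 hm hLt _ hω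
              (fun i j hij => ?_) (fun k => ?_) (fun k => ?_)
            · by_contra hlt
              exact hW1 (Set.mem_biUnion (x := (i, j)) (by simpa using hij) (not_le.1 hlt))
            · exact not_le.1 fun h => hW2 (Set.mem_iUnion.2 ⟨k, h⟩)
            · exact not_le.1 fun h => hW3 (Set.mem_iUnion.2 ⟨k, h⟩)
      _ ≤ P W + c := by
          rw [lintegral_add_right _ measurable_const, lintegral_const, measure_univ, mul_one]
          exact add_le_add_left (lintegral_indicator_one_le _) _
  have htotal : P {ω | γ < ‖q ω - Q‖} ≤ ENNReal.ofReal (2 * (n * r * E) + 2 * (m * H)) := by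
    calc P {ω | γ < ‖q ω - Q‖} ≤ P W + c := hPW
      _ ≤ (ENNReal.ofReal (n * r * E) + (ENNReal.ofReal (m * H) + ENNReal.ofReal (m * H))) +
          ENNReal.ofReal (n * r * E) := by
          rw [hceq]
          refine add_le_add ((measure_union_le _ _).trans (add_le_add hPgap
            ((measure_union_le _ _).trans (add_le_add ?_ ?_)))) le_rfl
          · exact hunion R fun k => hexp _ measurableSet_Ioi
          · exact hunion T fun k => hexp _ measurableSet_Iic
      _ = ENNReal.ofReal (2 * (n * r * E) + 2 * (m * H)) := by
          have hH0 : 0 < H := Real.exp_pos _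
          rw [← ENNReal.ofReal_add (by positivity) (by positivity),
            ← ENNReal.ofReal_add (by positivity) (by positivity),
            ← ENNReal.ofReal_add (by positivity) (by positivity)]
          congr 1; ring
  have hH0 : 0 < H := Real.exp_pos _
  refine (ENNReal.toReal_le_of_le_ofReal (by positivity) htotal).trans ?_
  have hr2 : r ≤ Real.sqrt (2 * Real.exp 1 * hi * m) := by
    refine Real.sqrt_le_sqrt ?_
    gcongr
    exact le_mul_of_one_le_right (by norm_num) (Real.one_le_exp zero_le_one)
  have h1 : n * r * E ≤ n * Real.sqrt (2 * Real.exp 1 * hi * m) * E := by gcongr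
  have h2 : 0 ≤ n * r * E := by positivity
  have h3 : 0 ≤ m * H := by positivity
  linarith
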